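/- Let $n\ge 1$ and view an input $x\in\{0,1\}^{3n}$ as a $3\times n$ table with rows $x^{(0)},x^{(1)},x^{(2)}\in\{0,1\}^{\mathbb Z/n}$. Call $x$ positive if its rows can be circularly shifted so that every column has XOR $0$, i.e. if there are $b,c\in\mathbb Z/n$ with $x^{(0)}_i\oplus x^{(1)}_{i+b}\oplus x^{(2)}_{i+c}=0$ for all $i\in\mathbb Z/n$. For $\varepsilon>0$, call $x$ $\varepsilon$-negative if it differs from every positive input in at least $3n\varepsilon$ of the $3n$ positions, i.e. if its relative Hamming distance to the set of positive inputs is at least $\varepsilon$. The property testing version of the 3-shift-sum problem is to distinguish positive inputs from $\varepsilon$-negative inputs, with no requirement on other inputs. Theorem. For $\varepsilon\le\frac17$ this problem requires $\Omega(n^{1/3})$ quantum queries. That is, there are $C>0$ and $n_0$ such that for all $n\ge n_0$ and all $0<\varepsilon\le\frac17$, every quantum query algorithm that accepts every positive input with probability at least $\frac23$ and every $\varepsilon$-negative input with probability at most $\frac13$ makes at least $C\,n^{1/3}$ queries. (A quantum query algorithm making $T$ queries starts in a fixed basis state, alternates $T+1$ arbitrary input-independent unitaries with $T$ applications of the oracle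 $|j,a,w\rangle\mapsto|j,a\oplus x_j,w\rangle$ on a finite-dimensional space, where $j$ ranges over the $3n$ input positions, $a\in\{0,1\}$ and $w$ is a workspace basis label, and finally measures in the computational basis, accepting on a fixed set of outcomes.) -/

import Mathlib

/-- A quantum query algorithm (circuit) for inputs `x : ι → Bool`.  Its state space has the
orthonormal basis `|i, b, w⟩`, with `i` in the query register, `b` in the answer register and `w`
in a workspace of arbitrary finite dimension `dim`.  The algorithm starts in the basis state
`init` and applies `U 0, O_x, U 1, O_x, …, O_x, U queries`; the `U t` are arbitrary unitaries that
do not depend on the input (those with `t > queries` are never applied), and `O_x` is the input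
oracle.  At the end it measures in the basis and accepts if the outcome lies in `accept`. -/
structure QuantumQueryAlgorithm (ι : Type) [Fintype ι] [DecidableEq ι] where
  dim : ℕ
  queries : ℕ
  init : ι × Bool × Fin dim
  U : ℕ → Matrix.unitaryGroup (ι × Bool × Fin dim) ℂ
  accept : Finset (ι × Bool × Fin dim)

namespace QuantumQueryAlgorithm

/-- The query oracle `O_x : |i, b, w⟩ ↦ |i, b ⊕ x i, w⟩`, as an operation on the vector of
amplitudes (`O_x` is its own inverse). -/
def oracle {ι : Type} {d : ℕ} (x : ι → Bool) (ψ : ι × Bool × Fin d → ℂ) :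
    ι × Bool × Fin d → ℂ :=
  fun p => ψ (p.1, p.2.1 ^^ x p.1, p.2.2)

/-- The state of the algorithm on input `x` right after the unitary `U t`, that is, after `t`
queries. -/
def state {ι : Type} [Fintype ι] [DecidableEq ι] (A : QuantumQueryAlgorithm ι) (x : ι → Bool) :
    ℕ → (ι × Bool × Fin A.dim → ℂ)
  | 0 => Matrix.mulVec (A.U 0).1 (Pi.single A.init 1)
  | t + 1 => Matrix.mulVec (A.U (t + 1)).1 (oracle x (A.state x t))

/-- The probability that the algorithm accepts the input `x`. -/
noncomputable def acceptProb {ι : Type} [Fintype ι] [DecidableEq ι]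
    (A : QuantumQueryAlgorithm ι) (x : ι → Bool) : ℝ :=
  ∑ p ∈ A.accept, ‖A.state x A.queries p‖ ^ 2

/-- The algorithm solves, with bounded error, the promise problem with positive inputs `P` and
negative inputs `N`. -/
def Solves {ι : Type} [Fintype ι] [DecidableEq ι] (A : QuantumQueryAlgorithm ι)
    (P N : Set (ι → Bool)) : Prop :=
  (∀ x ∈ P, 2 / 3 ≤ A.acceptProb x) ∧ (∀ x ∈ N, A.acceptProb x ≤ 1 / 3)

end QuantumQueryAlgorithm

/-- The positive inputs of Boolean 3-shift-sum: the `3 × n` tables whose rows can be circularly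
shifted so that every column has xor `0`.  Addition in `Fin n` is modulo `n`, and shifting the
second and third rows relative to the first one is enough. -/
def shiftSumPositive (n : ℕ) : Set (Fin 3 × Fin n → Bool) :=
  {x | ∃ b c : Fin n, ∀ i : Fin n, (x (0, i) ^^ x (1, i + b) ^^ x (2, i + c)) = false}

/-- The negative inputs of the property testing version: the tables at relative Hamming distance
at least `ε` from every positive input. -/
def shiftSumNegative (n : ℕ) (ε : ℝ) : Set (Fin 3 × Fin n → Bool) :=
  {x | ∀ y ∈ shiftSumPositive n, ε ≤ (hammingDist x y : ℝ) / (3 * n)}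

/-! The proof is an adversary argument carried out on Fourier coefficients. A pair of shifts `m` is
random. The positive side is the uniform distribution on the tables `P m` with even columns for
these shifts; the negative side is the uniform distribution on the whole cube.

Within a column a table of `P m` obeys a single parity constraint, which involves all three entries.
So the characters of sets with at most one position per column, the family `F m`, are orthogonal on
`P m` just as on the cube. A set of fewer than k positions cannot tell the two sides apart unless
two of its positions collide in a column. Adding one position to such a set creates a collision for
at most k·n of the n² shifts, a fraction k/n.

The progress is the mean over `m` of the sum over S in `F m`, |S| < k, of (k - |S|) times the inner
product of the S-th Fourier coefficients of the state on `P m` and on the cube. Unitaries preserve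
it (`progress_mulVec`), and the input-independent start gives k (`progress_single`). A query
multiplies part of the state by a one-position character, which moves S to S ± j. The weight then
changes by 1, or by at most k when S ∪ {j} leaves `F m`. For k³ ≤ n the latter has probability at
most 1/k², so the mean squared change is at most 2 and a query costs at most 3 (`progress_oracle`).
If the two sides are told apart, Cauchy-Schwarz with Bessel keeps the final progress below (69/70)k
(`progress_final`), so at least k/210 queries are made.

Finally, the cube is almost entirely negative: for fixed shifts the number of odd columns of a
uniform table is binomial with mean n/2 > 3n/7, and a Chernoff bound survives the union over n²
shifts (`eventually_card_not_negative_le`). -/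

open Finset

/-- The character `χ_S(x) = (-1)^{∑_{i ∈ S} x_i}` of the Boolean cube. -/
def boolChar {ι : Type} (S : Finset ι) (x : ι → Bool) : ℝ :=
  ∏ i ∈ S, if x i then -1 else 1

/-! ### Characters of the Boolean cube and their orthogonality -/

section Characters

variable {ι : Type}

lemma boolChar_empty (x : ι → Bool) : boolChar ∅ x = 1 := by simp [boolChar]

lemma boolChar_mul_self (S : Finset ι) (x : ι → Bool) : boolChar S x * boolChar S x = 1 := by
  rw [boolChar, ← prod_mul_distrib]
  exact prod_eq_one fun i _ => by split_ifs <;> norm_num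

lemma boolChar_xor (S : Finset ι) (x z : ι → Bool) :
    boolChar S (fun i => x i ^^ z i) = boolChar S x * boolChar S z := by
  rw [boolChar, boolChar, boolChar, ← prod_mul_distrib]
  refine prod_congr rfl fun i _ => ?_
  cases x i <;> cases z i <;> simp

lemma boolChar_insert [DecidableEq ι] {S : Finset ι} {j : ι} (h : j ∉ S) (x : ι → Bool) :
    boolChar (insert j S) x = boolChar S x * boolChar {j} x := by
  simp [boolChar, prod_insert h, mul_comm]

lemma abs_boolChar (S : Finset ι) (x : ι → Bool) : |boolChar S x| = 1 := by
  have h := boolChar_mul_self S x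
  have h2 : |boolChar S x| * |boolChar S x| = 1 := by rw [← abs_mul, h, abs_one]
  nlinarith [abs_nonneg (boolChar S x)]

/-- Two characters are orthogonal on a set of inputs that is invariant under a translation on
which their product is `-1`. -/
lemma sum_boolChar_mul_eq_zero (P : Finset (ι → Bool)) (S S' : Finset ι) (z : ι → Bool)
    (hP : ∀ x ∈ P, (fun i => x i ^^ z i) ∈ P) (hz : boolChar S z * boolChar S' z = -1) :
    ∑ x ∈ P, boolChar S x * boolChar S' x = 0 := by
  have h : ∑ x ∈ P, boolChar S x * boolChar S' x
      = ∑ x ∈ P, -(boolChar S x * boolChar S' x) := by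
    refine sum_bij' (fun x _ => fun i => x i ^^ z i) (fun x _ => fun i => x i ^^ z i) hP hP
      ?_ ?_ ?_
    · intro x _; funext i; simp
    · intro x _; funext i; simp
    · intro x _
      rw [boolChar_xor, boolChar_xor]
      linear_combination (boolChar S x * boolChar S' x) * hz
  rw [sum_neg_distrib] at h
  linarith

lemma sum_univ_boolChar_mul_eq_zero [Fintype ι] [DecidableEq ι] {S S' : Finset ι}
    (h : S ≠ S') : ∑ x, boolChar S x * boolChar S' x = 0 := by
  have key : ∀ {S S' : Finset ι}, (∃ e ∈ S, e ∉ S') →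
      ∑ x, boolChar S x * boolChar S' x = 0 := by
    rintro S S' ⟨e, he, he'⟩
    refine sum_boolChar_mul_eq_zero _ _ _ (fun i => decide (i = e)) (by simp) ?_
    have h1 : boolChar S (fun i => decide (i = e)) = -1 := by
      rw [boolChar, prod_eq_single e]
      · simp
      · intro b _ hb; simp [hb]
      · exact fun h => absurd he h
    have h2 : boolChar S' (fun i => decide (i = e)) = 1 := by
      refine prod_eq_one fun i hi => ?_
      have : i ≠ e := fun h => he' (h ▸ hi)
      simp [this]
    rw [h1, h2]; norm_num
  by_cases h1 : ∃ e ∈ S, e ∉ S'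
  · exact key h1
  · by_cases h2 : ∃ e ∈ S', e ∉ S
    · rw [← key h2]; exact sum_congr rfl fun x _ => mul_comm _ _
    · push Not at h1 h2
      exact absurd (Subset.antisymm h1 h2) h

end Characters

/-! ### Fourier coefficients relative to a set of inputs -/

section Fourier

variable {ι : Type} {E : Type*} [NormedAddCommGroup E] [InnerProductSpace ℝ E]

/-- The average of `g` over the inputs in `P`, weighted by the character `χ_S`. -/
noncomputable def fourierOn (P : Finset (ι → Bool)) (S : Finset ι) (g : (ι → Bool) → E) : E :=
  (#P : ℝ)⁻¹ • ∑ x ∈ P, boolChar S x • g x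

/-- The average of `‖g‖²` over the inputs in `P`. -/
noncomputable def meanSq (P : Finset (ι → Bool)) (g : (ι → Bool) → E) : ℝ :=
  (#P : ℝ)⁻¹ * ∑ x ∈ P, ‖g x‖ ^ 2

lemma meanSq_boolChar_smul (P : Finset (ι → Bool)) (S : Finset ι) (g : (ι → Bool) → E) :
    meanSq P (fun x => boolChar S x • g x) = meanSq P g := by
  simp [meanSq, norm_smul, abs_boolChar]

lemma meanSq_sub_le (P : Finset (ι → Bool)) (f g : (ι → Bool) → E) :
    meanSq P (f - g) ≤ 2 * (meanSq P f + meanSq P g) := by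
  unfold meanSq
  rw [← mul_add, ← sum_add_distrib, mul_left_comm, mul_sum _ _ (2 : ℝ)]
  gcongr with x
  have h := parallelogram_law_with_norm ℝ (f x) (g x)
  simp only [Pi.sub_apply]
  nlinarith [mul_self_nonneg ‖f x + g x‖]

lemma fourierOn_add (P : Finset (ι → Bool)) (S : Finset ι) (f g : (ι → Bool) → E) :
    fourierOn P S (f + g) = fourierOn P S f + fourierOn P S g := by
  simp [fourierOn, smul_add, sum_add_distrib]

lemma fourierOn_sub (P : Finset (ι → Bool)) (S : Finset ι) (f g : (ι → Bool) → E) :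
    fourierOn P S (f - g) = fourierOn P S f - fourierOn P S g := by
  simp [fourierOn, smul_sub, sum_sub_distrib]

lemma fourierOn_insert [DecidableEq ι] (P : Finset (ι → Bool)) {S : Finset ι} {j : ι}
    (h : j ∉ S) (g : (ι → Bool) → E) :
    fourierOn P (insert j S) g = fourierOn P S (fun x => boolChar {j} x • g x) := by
  simp [fourierOn, boolChar_insert h, mul_smul]

lemma fourierOn_insert_smul [DecidableEq ι] (P : Finset (ι → Bool)) {S : Finset ι} {j : ι}
    (h : j ∉ S) (g : (ι → Bool) → E) :
    fourierOn P (insert j S) (fun x => boolChar {j} x • g x) = fourierOn P S g := by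
  simp only [fourierOn, boolChar_insert h, smul_smul, mul_assoc, boolChar_mul_self, mul_one]

/-- Bessel's inequality for a family of characters that are orthogonal on `P`. -/
lemma sum_norm_fourierOn_sq_le (P : Finset (ι → Bool)) (F : Finset (Finset ι))
    (hF : ∀ S ∈ F, ∀ S' ∈ F, S ≠ S' → ∑ x ∈ P, boolChar S x * boolChar S' x = 0)
    (g : (ι → Bool) → E) :
    ∑ S ∈ F, ‖fourierOn P S g‖ ^ 2 ≤ meanSq P g := by
  classical
  rcases P.eq_empty_or_nonempty with rfl | hP
  · simp [fourierOn, meanSq]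
  have hc : (0 : ℝ) < #P := by exact_mod_cast hP.card_pos
  set c : ℝ := (#P : ℝ) with hcdef
  have hsum : ∀ S, ∑ x ∈ P, boolChar S x • g x = c • fourierOn P S g := by
    intro S; rw [fourierOn, smul_smul, mul_inv_cancel₀ hc.ne', one_smul]
  set G := fun S => fourierOn P S g with hG
  have hpos : 0 ≤ ∑ x ∈ P, ‖g x - ∑ S ∈ F, boolChar S x • G S‖ ^ 2 := by positivity
  have h1 : ∑ x ∈ P, inner ℝ (g x) (∑ S ∈ F, boolChar S x • G S) = c * ∑ S ∈ F, ‖G S‖ ^ 2 := by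
    simp only [inner_sum, inner_smul_right]
    rw [sum_comm, mul_sum]
    refine sum_congr rfl fun S _ => ?_
    have : ∑ x ∈ P, boolChar S x * inner ℝ (g x) (G S)
        = inner ℝ (∑ x ∈ P, boolChar S x • g x) (G S) := by
      simp [sum_inner, inner_smul_left]
    rw [this, hsum, inner_smul_left, hG, real_inner_self_eq_norm_sq]
    simp
  have h2 : ∑ x ∈ P, ‖∑ S ∈ F, boolChar S x • G S‖ ^ 2 = c * ∑ S ∈ F, ‖G S‖ ^ 2 := by
    have : ∀ x, ‖∑ S ∈ F, boolChar S x • G S‖ ^ 2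
        = ∑ S ∈ F, ∑ S' ∈ F, boolChar S x * boolChar S' x * inner ℝ (G S) (G S') := by
      intro x
      rw [← real_inner_self_eq_norm_sq, sum_inner]
      refine sum_congr rfl fun S _ => ?_
      rw [inner_sum]
      refine sum_congr rfl fun S' _ => ?_
      rw [inner_smul_left, inner_smul_right]
      simp [mul_assoc]
    simp only [this]
    rw [sum_comm, mul_sum]
    refine sum_congr rfl fun S hS => ?_
    rw [sum_comm, sum_eq_single_of_mem S hS]
    · simp [boolChar_mul_self, hcdef]
    · intro S' hS' hne
      rw [← sum_mul, hF S hS S' hS' (Ne.symm hne), zero_mul]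
  have h3 : ∑ x ∈ P, ‖g x - ∑ S ∈ F, boolChar S x • G S‖ ^ 2
      = ∑ x ∈ P, ‖g x‖ ^ 2 - c * ∑ S ∈ F, ‖G S‖ ^ 2 := by
    simp only [norm_sub_sq_real, sum_add_distrib, sum_sub_distrib, ← mul_sum, h1, h2]
    ring
  rw [meanSq, ← hcdef, inv_mul_eq_div, le_div_iff₀ hc]
  linarith [mul_comm c (∑ S ∈ F, ‖G S‖ ^ 2)]

end Fourier

/-! ### The weighted form between positive inputs and the cube -/

section Form

variable {ι M : Type} [Fintype M]
  {E : Type*} [NormedAddCommGroup E] [InnerProductSpace ℝ E]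

/-- The mean square of `g` over a random `P m`. -/
noncomputable def advMeanSq (P : M → Finset (ι → Bool)) (g : (ι → Bool) → E) : ℝ :=
  (Fintype.card M : ℝ)⁻¹ * ∑ m, meanSq (P m) g

variable [Fintype ι] [DecidableEq ι]

/-- The quadratic form with Fourier weights `c` between the input sets `P m` and the whole cube. -/
noncomputable def advForm (P : M → Finset (ι → Bool)) (c : M → Finset ι → ℝ)
    (g : (ι → Bool) → E) : ℝ :=
  (Fintype.card M : ℝ)⁻¹ *
    ∑ m, ∑ S, c m S * inner ℝ (fourierOn (P m) S g) (fourierOn univ S g)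

/-- Weighted AM-GM splits each term; Bessel bounds the `P m` part and the cube part. The cube
coefficient at S does not depend on `m`, so only the mean over `m` of `c m S ^ 2` matters. This lets
rare `m` carry large weights. -/
lemma abs_advForm_le [Nonempty M] (P : M → Finset (ι → Bool)) (F : M → Finset (Finset ι))
    (hF : ∀ m, ∀ S ∈ F m, ∀ S' ∈ F m, S ≠ S' → ∑ x ∈ P m, boolChar S x * boolChar S' x = 0)
    (c : M → Finset ι → ℝ) (hc : ∀ m, ∀ S ∉ F m, c m S = 0) (D s : ℝ) (hs : 0 < s)
    (hD : ∀ S, ∑ m, c m S ^ 2 ≤ D * Fintype.card M) (g : (ι → Bool) → E) :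
    |advForm P c g| ≤ (s * advMeanSq P g + D / s * meanSq univ g) / 2 := by
  have hM : (0 : ℝ) < Fintype.card M := by exact_mod_cast Fintype.card_pos
  have hD0 : 0 ≤ D := by
    have h1 : 0 ≤ D * Fintype.card M := le_trans (by positivity) (hD ∅)
    exact nonneg_of_mul_nonneg_left h1 hM
  have key : ∀ m, ∀ S ∈ (univ : Finset (Finset ι)),
      |c m S * inner ℝ (fourierOn (P m) S g) (fourierOn univ S g)|
      ≤ (s * (if S ∈ F m then ‖fourierOn (P m) S g‖ ^ 2 else 0)
          + c m S ^ 2 * (‖fourierOn univ S g‖ ^ 2 / s)) / 2 := by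
    intro m S _
    split_ifs with h
    · rw [abs_mul]
      have h1 := abs_real_inner_le_norm (fourierOn (P m) S g) (fourierOn univ S g)
      set u := ‖fourierOn (P m) S g‖
      set v := ‖fourierOn univ S g‖
      have h2 : |c m S| * (u * v) ≤ (s * u ^ 2 + c m S ^ 2 * (v ^ 2 / s)) / 2 := by
        rw [← sq_abs (c m S)]
        set d := |c m S|
        have h3 : s * u ^ 2 + d ^ 2 * (v ^ 2 / s) - 2 * (d * (u * v))
            = (s * u - d * v) ^ 2 / s := by field_simp; ring
        have h4 : 0 ≤ (s * u - d * v) ^ 2 / s := by positivity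
        linarith
      exact (mul_le_mul_of_nonneg_left h1 (abs_nonneg _)).trans h2
    · simp [hc m S h]
  have hB : ∀ m, ∑ S, (if S ∈ F m then ‖fourierOn (P m) S g‖ ^ 2 else 0) ≤ meanSq (P m) g := by
    intro m
    rw [← sum_filter, filter_mem_eq_inter, univ_inter]
    exact sum_norm_fourierOn_sq_le _ _ (hF m) g
  have hU : ∑ S : Finset ι, ‖fourierOn univ S g‖ ^ 2 ≤ meanSq univ g :=
    sum_norm_fourierOn_sq_le _ _ (fun S _ S' _ h => sum_univ_boolChar_mul_eq_zero h) g
  have hV : ∑ m, ∑ S, c m S ^ 2 * (‖fourierOn univ S g‖ ^ 2 / s)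
      ≤ Fintype.card M * (D / s * meanSq univ g) := by
    rw [sum_comm]
    simp only [← sum_mul]
    calc _ ≤ ∑ S : Finset ι, D * Fintype.card M * (‖fourierOn univ S g‖ ^ 2 / s) :=
          sum_le_sum fun S _ => mul_le_mul_of_nonneg_right (hD S) (by positivity)
      _ = D * Fintype.card M / s * ∑ S : Finset ι, ‖fourierOn univ S g‖ ^ 2 := by
          rw [mul_sum]; exact sum_congr rfl fun S _ => by ring
      _ ≤ D * Fintype.card M / s * meanSq univ g := by gcongr
      _ = _ := by ring
  have hS : |∑ m, ∑ S, c m S * inner ℝ (fourierOn (P m) S g) (fourierOn univ S g)|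
      ≤ (s * ∑ m, meanSq (P m) g + Fintype.card M * (D / s * meanSq univ g)) / 2 := by
    calc _ ≤ ∑ m, ∑ S, |c m S * inner ℝ (fourierOn (P m) S g) (fourierOn univ S g)| :=
          (abs_sum_le_sum_abs _ _).trans (sum_le_sum fun m _ => abs_sum_le_sum_abs _ _)
      _ ≤ _ := sum_le_sum fun m _ => sum_le_sum (key m)
      _ = (s * ∑ m, ∑ S, (if S ∈ F m then ‖fourierOn (P m) S g‖ ^ 2 else 0)
            + ∑ m, ∑ S, c m S ^ 2 * (‖fourierOn univ S g‖ ^ 2 / s)) / 2 := by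
          simp only [← sum_div, sum_add_distrib, ← mul_sum]
      _ ≤ _ := by
          gcongr with m
          exact hB m
  rw [advForm, advMeanSq, abs_mul, abs_of_pos (inv_pos.2 hM)]
  calc _ ≤ (Fintype.card M : ℝ)⁻¹ *
        ((s * ∑ m, meanSq (P m) g + Fintype.card M * (D / s * meanSq univ g)) / 2) := by gcongr
    _ = _ := by field_simp

lemma advForm_add_sub (P : M → Finset (ι → Bool)) (c : M → Finset ι → ℝ)
    (f g : (ι → Bool) → E) :
    advForm P c (f + g) + advForm P c (f - g) = 2 * (advForm P c f + advForm P c g) := by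
  simp only [advForm]
  rw [← mul_add, ← mul_add, mul_left_comm, ← sum_add_distrib, ← sum_add_distrib,
    mul_sum _ _ (2 : ℝ)]
  congr 1
  refine sum_congr rfl fun m _ => ?_
  rw [← sum_add_distrib, ← sum_add_distrib, mul_sum]
  refine sum_congr rfl fun S _ => ?_
  simp only [fourierOn_add, fourierOn_sub, inner_add_left, inner_add_right, inner_sub_left,
    inner_sub_right]
  ring

/-- Multiplying by the character of `j` shifts the weights by `j`. -/
lemma advForm_smul_sub (P : M → Finset (ι → Bool)) (c : M → Finset ι → ℝ) (j : ι)
    (g : (ι → Bool) → E) :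
    advForm P c (fun x => boolChar {j} x • g x) - advForm P c g
      = advForm P (fun m S => if j ∈ S then 0 else c m S - c m (insert j S))
          (fun x => boolChar {j} x • g x)
        - advForm P (fun m S => if j ∈ S then 0 else c m S - c m (insert j S)) g := by
  -- Pairing S with S ∪ {j} for S not containing j: multiplication by the character of j swaps the
  -- two coefficients of a pair.
  have split : ∀ f : Finset ι → ℝ, ∑ S : Finset ι, f S
      = ∑ S ∈ (univ.erase j).powerset, (f S + f (insert j S)) := by
    intro f
    rw [sum_add_distrib, ← sum_powerset_insert (notMem_erase j univ),
      insert_erase (mem_univ j), powerset_univ]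
  simp only [advForm]
  rw [← mul_sub, ← mul_sub,
    ← sum_sub_distrib, ← sum_sub_distrib]
  congr 1
  refine sum_congr rfl fun m _ => ?_
  rw [split, split, split, split, ← sum_sub_distrib, ← sum_sub_distrib]
  refine sum_congr rfl fun S hS => ?_
  have hj : j ∉ S := fun h => notMem_erase j univ (mem_powerset.1 hS h)
  simp only [fourierOn_insert_smul _ hj, fourierOn_insert _ hj, hj, mem_insert_self, if_true,
    if_false, zero_mul, add_zero]
  ring

end Form

/-! ### The progress measure and its change under queries -/

section Progress

variable {ι M κ : Type} [Fintype M]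

lemma sum_meanSq (P : Finset (ι → Bool)) (s : Finset κ) (ψ : (ι → Bool) → κ → ℂ) :
    ∑ p ∈ s, meanSq P (fun x => ψ x p) = (#P : ℝ)⁻¹ * ∑ x ∈ P, ∑ p ∈ s, ‖ψ x p‖ ^ 2 := by
  simp only [meanSq]
  rw [← mul_sum, sum_comm]

lemma sum_advMeanSq (P : M → Finset (ι → Bool)) (s : Finset κ) (ψ : (ι → Bool) → κ → ℂ) :
    ∑ p ∈ s, advMeanSq P (fun x => ψ x p)
      = (Fintype.card M : ℝ)⁻¹ * ∑ m, (#(P m) : ℝ)⁻¹ * ∑ x ∈ P m, ∑ p ∈ s, ‖ψ x p‖ ^ 2 := by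
  simp only [advMeanSq]
  rw [← mul_sum, sum_comm]
  simp only [sum_meanSq]

lemma advMeanSq_smul (P : M → Finset (ι → Bool)) (S : Finset ι) (g : (ι → Bool) → ℂ) :
    advMeanSq P (fun x => boolChar S x • g x) = advMeanSq P g := by
  simp only [advMeanSq, meanSq_boolChar_smul]

lemma advMeanSq_sub_le (P : M → Finset (ι → Bool)) (f g : (ι → Bool) → ℂ) :
    advMeanSq P (f - g) ≤ 2 * (advMeanSq P f + advMeanSq P g) := by
  simp only [advMeanSq]
  rw [← mul_add, ← sum_add_distrib, mul_left_comm, mul_sum _ _ (2 : ℝ)]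
  gcongr with m
  exact meanSq_sub_le _ _ _

variable [Fintype κ]

lemma sum_inner_mulVec [DecidableEq κ] (U : Matrix.unitaryGroup κ ℂ) (v w : κ → ℂ) :
    ∑ p, inner ℝ (Matrix.mulVec U.1 v p) (Matrix.mulVec U.1 w p) = ∑ p, inner ℝ (v p) (w p) := by
  have h : ∀ a b : κ → ℂ, ∑ p, inner ℝ (a p) (b p) = (dotProduct (star a) b).re := by
    intro a b
    simp [dotProduct, Complex.inner, mul_comm]
  rw [h, h, Matrix.star_mulVec, Matrix.dotProduct_mulVec, Matrix.vecMul_vecMul,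
    ← Matrix.star_eq_conjTranspose, Unitary.coe_star_mul_self, Matrix.vecMul_one]

lemma sum_norm_sq_mulVec [DecidableEq κ] (U : Matrix.unitaryGroup κ ℂ) (v : κ → ℂ) :
    ∑ p, ‖Matrix.mulVec U.1 v p‖ ^ 2 = ∑ p, ‖v p‖ ^ 2 := by
  simpa only [real_inner_self_eq_norm_sq] using sum_inner_mulVec U v v

lemma fourierOn_mulVec (P : Finset (ι → Bool)) (S : Finset ι) (U : Matrix κ κ ℂ)
    (ψ : (ι → Bool) → κ → ℂ) (p : κ) :
    fourierOn P S (fun x => Matrix.mulVec U (ψ x) p)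
      = Matrix.mulVec U (fun q => fourierOn P S (fun x => ψ x q)) p := by
  simp only [fourierOn, Matrix.mulVec, dotProduct, smul_sum, mul_sum]
  rw [sum_comm]
  refine sum_congr rfl fun q _ => sum_congr rfl fun x _ => ?_
  rw [mul_smul_comm, mul_smul_comm]

variable [Fintype ι] [DecidableEq ι]

/-- The quadratic form `advForm`, summed over all amplitudes of a family of states. -/
noncomputable def progress (P : M → Finset (ι → Bool)) (c : M → Finset ι → ℝ)
    (ψ : (ι → Bool) → κ → ℂ) : ℝ :=
  ∑ p, advForm P c (fun x => ψ x p)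

lemma progress_eq (P : M → Finset (ι → Bool)) (c : M → Finset ι → ℝ)
    (ψ : (ι → Bool) → κ → ℂ) :
    progress P c ψ = (Fintype.card M : ℝ)⁻¹ * ∑ m, ∑ S, c m S *
      ∑ p, inner ℝ (fourierOn (P m) S (fun x => ψ x p)) (fourierOn univ S (fun x => ψ x p)) := by
  simp only [progress, advForm, mul_sum]
  rw [sum_comm]
  refine sum_congr rfl fun m _ => ?_
  rw [sum_comm]

/-- An input-independent unitary commutes with taking Fourier coefficients and preserves their inner
products. -/
lemma progress_mulVec [DecidableEq κ] (P : M → Finset (ι → Bool)) (c : M → Finset ι → ℝ)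
    (U : Matrix.unitaryGroup κ ℂ) (ψ : (ι → Bool) → κ → ℂ) :
    progress P c (fun x => Matrix.mulVec U.1 (ψ x)) = progress P c ψ := by
  simp only [progress_eq, fourierOn_mulVec, sum_inner_mulVec]

/-- A family of input sets `P m` with families `F m` of index sets whose characters are orthogonal
on `P m`, such that a set of fewer than `k` indices rarely leaves `F m` when it is enlarged. -/
structure AdversaryFamily (P : M → Finset (ι → Bool)) (F : M → Finset (Finset ι)) (k : ℕ) :
    Prop where
  nonempty : ∀ m, (P m).Nonempty
  orthogonal : ∀ m, ∀ S ∈ F m, ∀ S' ∈ F m, S ≠ S' → ∑ x ∈ P m, boolChar S x * boolChar S' x = 0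
  empty_mem : ∀ m, ∅ ∈ F m
  of_insert : ∀ m S j, insert j S ∈ F m → S ∈ F m
  rare : ∀ S j, j ∉ S → #S < k →
    k ^ 2 * Nat.card {m // S ∈ F m ∧ insert j S ∉ F m} ≤ Fintype.card M

/-- The weight `k - |S|` of a set in `F m`, where it is positive. -/
def advWeight (F : M → Finset (Finset ι)) (k : ℕ) (m : M) (S : Finset ι) : ℝ :=
  if S ∈ F m then ((k - #S : ℕ) : ℝ) else 0

namespace AdversaryFamily

variable {P : M → Finset (ι → Bool)} {F : M → Finset (Finset ι)} {k : ℕ}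

/-- In the Hadamard basis of the answer bit the query is diagonal: it fixes `g₀ + g₁` and multiplies
`g₀ - g₁` by the character of j. Only the difference changes the form, and there the weights are
replaced by their discrete derivative in j. -/
lemma abs_progress_pair [Nonempty M] (h : AdversaryFamily P F k) (j : ι)
    (g₀ g₁ h₀ h₁ : (ι → Bool) → ℂ) (e₀ : ∀ x, h₀ x = if x j then g₁ x else g₀ x)
    (e₁ : ∀ x, h₁ x = if x j then g₀ x else g₁ x) :
    (advForm P (advWeight F k) g₀ + advForm P (advWeight F k) g₁)
      - (advForm P (advWeight F k) h₀ + advForm P (advWeight F k) h₁)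
      ≤ (advMeanSq P g₀ + advMeanSq P g₁) + 2 * (meanSq univ g₀ + meanSq univ g₁) := by
  set c := advWeight F k with hc
  set c' : M → Finset ι → ℝ := fun m S => if j ∈ S then 0 else c m S - c m (insert j S) with hc'
  have hadd : h₀ + h₁ = g₀ + g₁ := by
    funext x; simp only [Pi.add_apply, e₀, e₁]; split_ifs <;> ring
  have hsub : h₀ - h₁ = fun x => boolChar {j} x • (g₀ - g₁) x := by
    funext x
    simp only [Pi.sub_apply, e₀, e₁, boolChar, prod_singleton]
    split_ifs <;> simp
  have hF0 : ∀ m, ∀ S ∉ F m, c' m S = 0 := by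
    intro m S hS
    have h2 : insert j S ∉ F m := fun h2 => hS (h.of_insert m S j h2)
    simp [hc', hc, advWeight, hS, h2]
  -- For |S| < k the squared derivative is 1 if S ∪ {j} stays in `F m`, and at most k² on an event
  -- which `rare` makes of probability at most 1/k².
  have hD : ∀ S, ∑ m, c' m S ^ 2 ≤ 2 * Fintype.card M := by
    intro S
    by_cases hj : j ∈ S
    · simp [hc', hj]
    by_cases hk : #S < k
    · classical
      have hb : ∀ m ∈ (univ : Finset M), c' m S ^ 2
          ≤ 1 + if S ∈ F m ∧ insert j S ∉ F m then (k : ℝ) ^ 2 else 0 := by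
        intro m _
        by_cases h1 : S ∈ F m
        · by_cases h2 : insert j S ∈ F m
          · have h3 : ((k - #S : ℕ) : ℝ) - ((k - (#S + 1) : ℕ) : ℝ) = 1 := by
              rw [Nat.cast_sub hk.le, Nat.cast_sub hk]; push_cast; ring
            simp [hc', hj, hc, advWeight, h1, h2, card_insert_of_notMem hj, h3]
          · have h3 : ((k - #S : ℕ) : ℝ) ^ 2 ≤ (k : ℝ) ^ 2 := by gcongr; omega
            simp only [hc', hj, hc, advWeight, h1, h2, if_true, if_false, not_false_eq_true,
              and_self, sub_zero]
            linarith
        · rw [hF0 m S h1]; simp [h1]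
      refine (sum_le_sum hb).trans ?_
      have hr := h.rare S j hj hk
      rw [Nat.card_eq_fintype_card, Fintype.card_subtype] at hr
      have hr' : ((k : ℝ) ^ 2 * (#{m | S ∈ F m ∧ insert j S ∉ F m} : ℕ)) ≤ Fintype.card M := by
        exact_mod_cast hr
      rw [sum_add_distrib, ← sum_filter, sum_const, sum_const, nsmul_eq_mul, nsmul_eq_mul,
        card_univ]
      linarith
    · have h0 : ∀ m, c' m S = 0 := by
        intro m
        have h1 : k - #S = 0 := by omega
        have h2 : k - (#S + 1) = 0 := by omega
        simp [hc', hj, hc, advWeight, card_insert_of_notMem hj, h1, h2]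
      simp [h0]
  have b₁ := abs_advForm_le P F h.orthogonal c' hF0 2 1 one_pos hD (g₀ - g₁)
  have b₂ := abs_advForm_le P F h.orthogonal c' hF0 2 1 one_pos hD (h₀ - h₁)
  have p₁ := advForm_add_sub P c g₀ g₁
  have p₂ := advForm_add_sub P c h₀ h₁
  have q := advForm_smul_sub P c j (g₀ - g₁)
  have n₁ := advMeanSq_sub_le P g₀ g₁
  have n₂ := meanSq_sub_le univ g₀ g₁
  rw [hadd] at p₂
  rw [← hsub, ← hc'] at q
  have m₁ : advMeanSq P (h₀ - h₁) = advMeanSq P (g₀ - g₁) := by rw [hsub, advMeanSq_smul]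
  have m₂ : meanSq univ (h₀ - h₁) = meanSq univ (g₀ - g₁) := by
    rw [hsub, meanSq_boolChar_smul]
  rw [m₁, m₂] at b₂
  have b₁' := abs_le.1 b₁
  have b₂' := abs_le.1 b₂
  linarith [b₁'.1, b₁'.2, b₂'.1, b₂'.2]

/-- The loss 3 is 1 + 2: the pairwise bounds add up to the total mass on the positive side plus
twice that on the cube, and both masses are 1. -/
lemma progress_oracle [Nonempty M] (h : AdversaryFamily P F k) {d : ℕ}
    (ψ : (ι → Bool) → ι × Bool × Fin d → ℂ) (hψ : ∀ x, ∑ p, ‖ψ x p‖ ^ 2 = 1) :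
    progress P (advWeight F k) ψ - 3
      ≤ progress P (advWeight F k) (fun x => QuantumQueryAlgorithm.oracle x (ψ x)) := by
  have hsum : ∀ f : ι × Bool × Fin d → ℝ,
      ∑ p, f p = ∑ j, ∑ w, (f (j, false, w) + f (j, true, w)) := by
    intro f
    rw [Fintype.sum_prod_type]
    refine sum_congr rfl fun j _ => ?_
    rw [Fintype.sum_prod_type, Fintype.sum_bool, sum_add_distrib, add_comm]
  have h1 : ∑ p, advMeanSq P (fun x => ψ x p) = 1 := by
    rw [sum_advMeanSq]
    simp only [hψ]
    have : ∀ m, (#(P m) : ℝ)⁻¹ * ∑ x ∈ P m, (1 : ℝ) = 1 := by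
      intro m
      have : (#(P m) : ℝ) ≠ 0 := by exact_mod_cast (h.nonempty m).card_pos.ne'
      simp [this]
    simp only [this]
    simp
  have h2 : ∑ p, meanSq univ (fun x => ψ x p) = 1 := by
    rw [sum_meanSq]
    simp [hψ]
  have key : progress P (advWeight F k) ψ
      - progress P (advWeight F k) (fun x => QuantumQueryAlgorithm.oracle x (ψ x))
      ≤ ∑ p, advMeanSq P (fun x => ψ x p) + 2 * ∑ p, meanSq univ (fun x => ψ x p) := by
    simp only [progress]
    rw [hsum, hsum, hsum, hsum, mul_sum, ← sum_sub_distrib, ← sum_add_distrib]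
    refine sum_le_sum fun j _ => ?_
    rw [mul_sum, ← sum_sub_distrib, ← sum_add_distrib]
    refine sum_le_sum fun w _ => ?_
    refine h.abs_progress_pair j _ _ _ _ ?_ ?_
    · intro x; cases hx : x j <;> simp [QuantumQueryAlgorithm.oracle, hx]
    · intro x; cases hx : x j <;> simp [QuantumQueryAlgorithm.oracle, hx]
  rw [h1, h2] at key
  linarith

/-- A constant function has no nonempty Fourier coefficient on the cube, so only the weight k of ∅
remains. -/
lemma progress_single [Nonempty M] [DecidableEq κ] (h : AdversaryFamily P F k) (p₀ : κ) :
    progress P (advWeight F k) (fun _ => Pi.single p₀ 1) = k := by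
  have hM : (Fintype.card M : ℝ) ≠ 0 := by exact_mod_cast Fintype.card_ne_zero
  rw [progress, sum_eq_single p₀]
  · simp only [Pi.single_eq_same, advForm]
    have hu : ∀ S : Finset ι, S ≠ ∅ → fourierOn univ S (fun _ => (1 : ℂ)) = 0 := by
      intro S hS
      have := sum_univ_boolChar_mul_eq_zero hS
      simp only [boolChar_empty, mul_one] at this
      rw [fourierOn, ← sum_smul, this, zero_smul, smul_zero]
    have he : ∀ Q : Finset (ι → Bool), Q.Nonempty → fourierOn Q ∅ (fun _ => (1 : ℂ)) = 1 := by
      intro Q hQ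
      have : (#Q : ℂ) ≠ 0 := by exact_mod_cast hQ.card_pos.ne'
      simp [fourierOn, boolChar_empty, this]
    have hm : ∀ m, ∑ S, advWeight F k m S * inner ℝ (fourierOn (P m) S fun _ => (1 : ℂ))
        (fourierOn univ S fun _ => (1 : ℂ)) = k := by
      intro m
      rw [sum_eq_single ∅]
      · rw [he _ (h.nonempty m), he _ univ_nonempty]
        simp [advWeight, h.empty_mem]
      · intro S _ hS; rw [hu S hS]; simp
      · simp
    simp only [hm]
    simp [hM]
  · intro p _ hp
    simp [hp, advForm, fourierOn]
  · simp

/-- The progress is bounded away from `k` once the two distributions are told apart. -/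
lemma progress_final [Nonempty M] (h : AdversaryFamily P F k) (hk : 0 < k) (s : Finset κ)
    (ψ : (ι → Bool) → κ → ℂ) (hψ : ∀ x, ∑ p, ‖ψ x p‖ ^ 2 = 1)
    (hP : ∀ m, ∀ x ∈ P m, 2 / 3 ≤ ∑ p ∈ s, ‖ψ x p‖ ^ 2)
    (hN : (Fintype.card (ι → Bool) : ℝ)⁻¹ * ∑ x, ∑ p ∈ s, ‖ψ x p‖ ^ 2 ≤ 1 / 2) :
    progress P (advWeight F k) ψ ≤ 69 / 70 * k := by
  classical
  have hM : (0 : ℝ) < Fintype.card M := by exact_mod_cast Fintype.card_pos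
  have hk' : (0 : ℝ) < k := by exact_mod_cast hk
  have hF0 : ∀ m, ∀ S ∉ F m, advWeight F k m S = 0 := fun m S hS => by simp [advWeight, hS]
  have hD : ∀ S, ∑ m, advWeight F k m S ^ 2 ≤ (k : ℝ) ^ 2 * Fintype.card M := by
    intro S
    have : ∀ m ∈ (univ : Finset M), advWeight F k m S ^ 2 ≤ (k : ℝ) ^ 2 := by
      intro m _
      unfold advWeight
      split_ifs
      · gcongr; omega
      · simp
    refine (sum_le_sum this).trans ?_
    simp [mul_comm]
  have hb : ∀ (r : ℝ), 0 < r → ∀ g : (ι → Bool) → ℂ, advForm P (advWeight F k) g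
      ≤ k / 2 * (r * advMeanSq P g + r⁻¹ * meanSq univ g) := by
    intro r hr g
    refine (le_abs_self _).trans ((abs_advForm_le P F h.orthogonal _ hF0 _ (k * r)
      (by positivity) hD g).trans (le_of_eq ?_))
    field_simp
  have hsplit : progress P (advWeight F k) ψ
      = ∑ p ∈ s, advForm P (advWeight F k) (fun x => ψ x p)
        + ∑ p ∈ sᶜ, advForm P (advWeight F k) (fun x => ψ x p) := (sum_add_sum_compl _ _).symm
  have hs : ∀ (r : ℝ), 0 < r → ∀ s : Finset κ,
      ∑ p ∈ s, advForm P (advWeight F k) (fun x => ψ x p)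
      ≤ k / 2 * (r * ∑ p ∈ s, advMeanSq P (fun x => ψ x p)
          + r⁻¹ * ∑ p ∈ s, meanSq univ (fun x => ψ x p)) := by
    intro r hr s
    rw [mul_sum, mul_sum, ← sum_add_distrib, mul_sum]
    exact sum_le_sum fun p _ => hb r hr _
  have hP1 : ∀ m, (#(P m) : ℝ)⁻¹ * ∑ x ∈ P m, (1 : ℝ) = 1 := by
    intro m
    have : (#(P m) : ℝ) ≠ 0 := by exact_mod_cast (h.nonempty m).card_pos.ne'
    simp [this]
  have t₁ : ∑ p, advMeanSq P (fun x => ψ x p) = 1 := by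
    rw [sum_advMeanSq]
    simp only [hψ, hP1]
    simp
  have t₂ : ∑ p, meanSq univ (fun x => ψ x p) = 1 := by
    rw [sum_meanSq]
    simp [hψ]
  rw [← sum_add_sum_compl s] at t₁ t₂
  have a₁ : 2 / 3 ≤ ∑ p ∈ s, advMeanSq P (fun x => ψ x p) := by
    rw [sum_advMeanSq]
    have : ∀ m ∈ (univ : Finset M),
        (2 / 3 : ℝ) ≤ (#(P m) : ℝ)⁻¹ * ∑ x ∈ P m, ∑ p ∈ s, ‖ψ x p‖ ^ 2 := by
      intro m _
      have h1 : (2 / 3 : ℝ) = (#(P m) : ℝ)⁻¹ * ∑ x ∈ P m, (2 / 3 : ℝ) := by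
        rw [show ∑ x ∈ P m, (2 / 3 : ℝ) = 2 / 3 * ∑ x ∈ P m, (1 : ℝ) by rw [mul_sum, mul_one],
          mul_left_comm, hP1 m, mul_one]
      refine h1.le.trans (mul_le_mul_of_nonneg_left (sum_le_sum fun x hx => hP m x hx) ?_)
      exact inv_nonneg.2 (Nat.cast_nonneg _)
    have h2 := sum_le_sum this
    rw [sum_const, nsmul_eq_mul, card_univ] at h2
    rw [inv_mul_eq_div, le_div_iff₀ hM]
    linarith
  have a₂ : ∑ p ∈ s, meanSq univ (fun x => ψ x p) ≤ 1 / 2 := by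
    rw [sum_meanSq, card_univ]
    exact hN
  -- The best `r` is the square root of the ratio of cube mass to positive mass. In the extreme case
  -- this ratio is 1/2 : 2/3 on `s` and 1/2 : 1/3 on `sᶜ`, giving roughly 6/7 and 6/5.
  have b₁ := hs (6 / 7) (by norm_num) s
  have b₂ := hs (6 / 5) (by norm_num) sᶜ
  set A := ∑ p ∈ s, advMeanSq P (fun x => ψ x p)
  set A' := ∑ p ∈ sᶜ, advMeanSq P (fun x => ψ x p)
  set B := ∑ p ∈ s, meanSq univ (fun x => ψ x p)
  set B' := ∑ p ∈ sᶜ, meanSq univ (fun x => ψ x p)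
  have hfin : (6 / 7 : ℝ) * A + (6 / 7)⁻¹ * B + (6 / 5 * A' + (6 / 5)⁻¹ * B') ≤ 69 / 35 := by
    norm_num
    linarith
  have := mul_le_mul_of_nonneg_left hfin (show (0 : ℝ) ≤ k / 2 by positivity)
  linarith

end AdversaryFamily

end Progress

/-! ### From adversary families to query lower bounds -/

namespace QuantumQueryAlgorithm

lemma sum_norm_oracle_sq {ι : Type} [Fintype ι] {d : ℕ} (x : ι → Bool) (ψ : ι × Bool × Fin d → ℂ) :
    ∑ p, ‖oracle x ψ p‖ ^ 2 = ∑ p, ‖ψ p‖ ^ 2 := by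
  simp only [oracle]
  rw [Fintype.sum_prod_type, Fintype.sum_prod_type]
  refine sum_congr rfl fun j _ => ?_
  rw [Fintype.sum_prod_type, Fintype.sum_prod_type, Fintype.sum_bool, Fintype.sum_bool]
  cases hx : x j <;> simp [hx, add_comm]

variable {ι : Type} [Fintype ι] [DecidableEq ι]

lemma sum_norm_state_sq (A : QuantumQueryAlgorithm ι) (x : ι → Bool) (t : ℕ) :
    ∑ p, ‖A.state x t p‖ ^ 2 = 1 := by
  induction t with
  | zero =>
    rw [state, sum_norm_sq_mulVec, sum_eq_single A.init]
    · simp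
    · intro p _ hp; simp [hp]
    · simp
  | succ t ih => rw [state, sum_norm_sq_mulVec, sum_norm_oracle_sq, ih]

lemma acceptProb_le_one (A : QuantumQueryAlgorithm ι) (x : ι → Bool) : A.acceptProb x ≤ 1 := by
  rw [← A.sum_norm_state_sq x A.queries]
  exact sum_le_sum_of_subset_of_nonneg (subset_univ _) fun _ _ _ => by positivity

variable {M : Type} [Fintype M] [Nonempty M] {P : M → Finset (ι → Bool)}
  {F : M → Finset (Finset ι)} {k : ℕ}

lemma le_progress_state (A : QuantumQueryAlgorithm ι) (h : AdversaryFamily P F k) (t : ℕ) :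
    (k : ℝ) - 3 * t ≤ progress P (advWeight F k) (fun x => A.state x t) := by
  induction t with
  | zero =>
    simp only [state]
    rw [progress_mulVec, h.progress_single]
    simp
  | succ t ih =>
    simp only [state]
    rw [progress_mulVec]
    have := h.progress_oracle (fun x => A.state x t) (fun x => A.sum_norm_state_sq x t)
    push_cast
    linarith

/-- An algorithm that accepts on every `P m` but not on average over the whole cube makes
`Ω(k)` queries. -/
theorem le_queries_of_adversaryFamily (A : QuantumQueryAlgorithm ι) (h : AdversaryFamily P F k)
    (hP : ∀ m, ∀ x ∈ P m, 2 / 3 ≤ A.acceptProb x)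
    (hN : (Fintype.card (ι → Bool) : ℝ)⁻¹ * ∑ x, A.acceptProb x ≤ 1 / 2) :
    (k : ℝ) / 210 ≤ A.queries := by
  rcases k.eq_zero_or_pos with rfl | hk
  · simp
  have h1 := A.le_progress_state h A.queries
  have h2 := h.progress_final hk A.accept (fun x => A.state x A.queries)
    (fun x => A.sum_norm_state_sq x _) hP hN
  linarith

end QuantumQueryAlgorithm

/-! ### Combinatorics of shifted tables -/

section ShiftSum

variable {n : ℕ}

/-- The tables that become columnwise even after shifting the rows by `0, b, c`. -/
def shiftTables (m : Fin n × Fin n) : Finset (Fin 3 × Fin n → Bool) :=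
  univ.filter fun x => ∀ i, (x (0, i) ^^ x (1, i + m.1) ^^ x (2, i + m.2)) = false

lemma mem_shiftTables {m : Fin n × Fin n} {x : Fin 3 × Fin n → Bool} :
    x ∈ shiftTables m ↔ ∀ i, (x (0, i) ^^ x (1, i + m.1) ^^ x (2, i + m.2)) = false := by
  simp [shiftTables]

/-- The number of odd columns after shifting the rows by `0, b, c`. -/
def oddColumns (m : Fin n × Fin n) (x : Fin 3 × Fin n → Bool) : ℕ :=
  #{i | (x (0, i) ^^ x (1, i + m.1) ^^ x (2, i + m.2)) = true}

/-- The column in which a position ends up after shifting the rows by `0, b, c`. -/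
def shiftColumn [NeZero n] (m : Fin n × Fin n) (p : Fin 3 × Fin n) : Fin n :=
  p.2 - ![0, m.1, m.2] p.1

/-- Every odd column of `x` contains a position where `x` and `y` differ, since `y` has no odd
column. -/
lemma oddColumns_le_hammingDist [NeZero n] (m : Fin n × Fin n) (x y : Fin 3 × Fin n → Bool)
    (hy : y ∈ shiftTables m) : oddColumns m x ≤ hammingDist x y := by
  rw [mem_shiftTables] at hy
  have hsub : ({i | (x (0, i) ^^ x (1, i + m.1) ^^ x (2, i + m.2)) = true} : Finset (Fin n))
      ⊆ ({p | x p ≠ y p} : Finset (Fin 3 × Fin n)).image (shiftColumn m) := by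
    intro i hi
    simp only [mem_filter, mem_univ, true_and] at hi
    have hy' := hy i
    simp only [mem_image, mem_filter, mem_univ, true_and]
    by_contra! hcon
    have e0 : x (0, i) = y (0, i) := by
      by_contra hne; exact hcon _ hne (by simp [shiftColumn])
    have e1 : x (1, i + m.1) = y (1, i + m.1) := by
      by_contra hne; exact hcon _ hne (by simp [shiftColumn])
    have e2 : x (2, i + m.2) = y (2, i + m.2) := by
      by_contra hne; exact hcon _ hne (by simp [shiftColumn])
    rw [e0, e1, e2, hy'] at hi
    exact absurd hi (by simp)
  exact (card_le_card hsub).trans card_image_le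

/-- Adding the shifted second and third row to the first one. -/
def columnParity (m : Fin n × Fin n) (x : Fin 3 × Fin n → Bool) : Fin 3 × Fin n → Bool :=
  fun p => if p.1 = 0 then x p ^^ x (1, p.2 + m.1) ^^ x (2, p.2 + m.2) else x p

lemma columnParity_involutive (m : Fin n × Fin n) : Function.Involutive (columnParity m) := by
  intro x
  funext ⟨r, i⟩
  by_cases hr : r = 0
  · simp only [columnParity, hr, if_true, one_ne_zero, if_false, Fin.reduceEq]
    cases x (0, i) <;> cases x (1, i + m.1) <;> cases x (2, i + m.2) <;> rfl
  · simp [columnParity, hr]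

/-- The exponential moment of the number of odd columns. -/
lemma sum_pow_oddColumns (m : Fin n × Fin n) (a : ℝ) :
    ∑ x, a ^ oddColumns m x = (a + 1) ^ n * (2 ^ n * 2 ^ n) := by
  -- The substitution `columnParity` turns odd columns into ones of the first row, after which the
  -- sum factors over positions.
  have h1 : ∑ x, a ^ oddColumns m x
      = ∑ x : Fin 3 × Fin n → Bool, ∏ p, if p.1 = 0 ∧ x p = true then a else 1 := by
    refine Fintype.sum_equiv (columnParity_involutive m).toPerm _ _ fun x => ?_
    rw [Fintype.prod_prod_type, Fin.prod_univ_three]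
    simp only [Function.Involutive.coe_toPerm, columnParity, oddColumns, true_and, if_true,
      one_ne_zero, if_false, Fin.reduceEq, false_and, prod_const_one, mul_one]
    rw [prod_ite, prod_const_one, mul_one, prod_const]
  rw [h1]
  have h2 := (Fintype.prod_sum
    (fun (p : Fin 3 × Fin n) (b : Bool) => if p.1 = 0 ∧ b = true then a else (1 : ℝ))).symm
  rw [h2, Fintype.prod_prod_type, Fin.prod_univ_three]
  simp only [Fintype.sum_bool, true_and, if_true, one_ne_zero, if_false, Fin.reduceEq, false_and,
    Bool.false_eq_true, prod_const, card_univ, Fintype.card_fin]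
  norm_num [mul_assoc]

/-- The sets of positions with at most one position in each shifted column. -/
def columnInjective [NeZero n] (m : Fin n × Fin n) : Finset (Finset (Fin 3 × Fin n)) :=
  univ.filter fun S => ∀ p ∈ S, ∀ q ∈ S, shiftColumn m p = shiftColumn m q → p = q

lemma mem_columnInjective [NeZero n] {m : Fin n × Fin n} {S : Finset (Fin 3 × Fin n)} :
    S ∈ columnInjective m ↔
      ∀ p ∈ S, ∀ q ∈ S, shiftColumn m p = shiftColumn m q → p = q := by
  simp [columnInjective]

lemma eq_of_shiftColumn_eq [NeZero n] {m : Fin n × Fin n} {p q : Fin 3 × Fin n}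
    (h : shiftColumn m p = shiftColumn m q) (hr : p.1 = q.1) : p = q := by
  unfold shiftColumn at h
  rw [hr] at h
  exact Prod.ext hr (sub_left_inj.1 h)

/-- The symmetric difference of S and S' has at most two positions in any column, so it never
contains a full parity constraint, and some translation preserving the tables flips the product of
the two characters. -/
lemma sum_shiftTables_boolChar [NeZero n] (m : Fin n × Fin n) {S S' : Finset (Fin 3 × Fin n)}
    (hS : S ∈ columnInjective m) (hS' : S' ∈ columnInjective m) (hne : S ≠ S') :
    ∑ x ∈ shiftTables m, boolChar S x * boolChar S' x = 0 := by
  have key : ∀ {S S' : Finset (Fin 3 × Fin n)}, S ∈ columnInjective m →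
      S' ∈ columnInjective m → (∃ e ∈ S, e ∉ S') →
      ∑ x ∈ shiftTables m, boolChar S x * boolChar S' x = 0 := by
    rintro S S' hS hS' ⟨e, he, he'⟩
    rw [mem_columnInjective] at hS hS'
    -- `t` is the row that must stay fixed in the column of `e`: that of the element of S' there, if
    -- any.
    obtain ⟨t, ht, htS⟩ : ∃ t : Fin 3, e.1 ≠ t ∧
        ∀ p ∈ S', shiftColumn m p = shiftColumn m e → p.1 = t := by
      by_cases hex : ∃ f ∈ S', shiftColumn m f = shiftColumn m e
      · obtain ⟨f, hf, hfe⟩ := hex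
        refine ⟨f.1, fun h => he' ?_, fun p hp hpe => ?_⟩
        · rwa [eq_of_shiftColumn_eq hfe.symm h]
        · rw [hS' p hp f hf (hpe.trans hfe.symm)]
      · push Not at hex
        obtain ⟨t, ht⟩ := exists_ne e.1
        exact ⟨t, ht.symm, fun p hp h => absurd h (hex p hp)⟩
    -- Flipping the two entries outside row `t` in the column of `e` keeps its parity, meets S
    -- exactly in `e` and avoids S'.
    refine sum_boolChar_mul_eq_zero _ _ _
      (fun p => decide (shiftColumn m p = shiftColumn m e ∧ p.1 ≠ t)) ?_ ?_
    · intro x hx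
      rw [mem_shiftTables] at hx ⊢
      intro i
      have hxi := hx i
      have c0 : shiftColumn m (0, i) = i := by simp [shiftColumn]
      have c1 : shiftColumn m (1, i + m.1) = i := by simp [shiftColumn]
      have c2 : shiftColumn m (2, i + m.2) = i := by simp [shiftColumn]
      simp only [c0, c1, c2]
      by_cases hi : i = shiftColumn m e
      · have h3 : (decide ((0 : Fin 3) ≠ t) ^^ decide ((1 : Fin 3) ≠ t)
            ^^ decide ((2 : Fin 3) ≠ t)) = false := by
          clear ht htS
          revert t; decide
        simp only [hi, true_and] at hxi ⊢
        generalize decide ((0 : Fin 3) ≠ t) = u at *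
        generalize decide ((1 : Fin 3) ≠ t) = v at *
        generalize decide ((2 : Fin 3) ≠ t) = w at *
        generalize x (0, shiftColumn m e) = u' at *
        generalize x (1, shiftColumn m e + m.1) = v' at *
        generalize x (2, shiftColumn m e + m.2) = w' at *
        revert h3 hxi
        revert u v w u' v' w'
        decide
      · simpa [hi] using hxi
    · have h1 : boolChar S (fun p => decide (shiftColumn m p = shiftColumn m e ∧ p.1 ≠ t))
          = -1 := by
        rw [boolChar, prod_eq_single e]
        · simp [ht]
        · intro p hp hpe
          have : shiftColumn m p ≠ shiftColumn m e := fun h => hpe (hS p hp e he h)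
          simp [this]
        · exact fun h => absurd he h
      have h2 : boolChar S' (fun p => decide (shiftColumn m p = shiftColumn m e ∧ p.1 ≠ t))
          = 1 := by
        refine prod_eq_one fun p hp => ?_
        have : ¬(shiftColumn m p = shiftColumn m e ∧ p.1 ≠ t) := fun h => h.2 (htS p hp h.1)
        simp [this]
      rw [h1, h2]; norm_num
  by_cases h1 : ∃ e ∈ S, e ∉ S'
  · exact key hS hS' h1
  · by_cases h2 : ∃ e ∈ S', e ∉ S
    · rw [← key hS' hS h2]; exact sum_congr rfl fun x _ => mul_comm _ _
    · push Not at h1 h2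
      exact absurd (Subset.antisymm h1 h2) hne

/-- Two positions end up in the same column for few shifts. -/
lemma card_shiftColumn_eq_le [NeZero n] {p q : Fin 3 × Fin n} (hpq : p ≠ q) :
    #{m : Fin n × Fin n | shiftColumn m p = shiftColumn m q} ≤ n := by
  -- It suffices that one coordinate of `m` determines `m` among the colliding shifts; two positions
  -- of the same row never collide.
  have hinj : ∀ f : Fin n × Fin n → Fin n,
      (∀ m m', shiftColumn m p = shiftColumn m q → shiftColumn m' p = shiftColumn m' q →
        f m = f m' → m = m') →
      #{m : Fin n × Fin n | shiftColumn m p = shiftColumn m q} ≤ n := by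
    intro f hf
    have : #{m : Fin n × Fin n | shiftColumn m p = shiftColumn m q}
        ≤ #(univ : Finset (Fin n)) := by
      refine card_le_card_of_injOn f (fun _ _ => mem_coe.2 (mem_univ _)) ?_
      intro m hm m' hm'
      simp only [coe_filter, mem_univ, true_and, Set.mem_ofPred_eq] at hm hm'
      exact hf m m' hm hm'
    simpa using this
  obtain ⟨r, i⟩ := p
  obtain ⟨r', i'⟩ := q
  by_cases hr : r = r'
  · refine hinj Prod.fst fun m m' h _ _ => absurd (eq_of_shiftColumn_eq h hr) hpq
  have hsolve : ∀ a b a' b' : Fin n, i - a = i' - b → i - a' = i' - b' → (a = a' ↔ b = b') := by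
    intro a b a' b' h h'
    constructor
    · rintro rfl; exact sub_right_inj.1 (h.symm.trans h')
    · rintro rfl; exact sub_right_inj.1 (h.trans h'.symm)
  have hv : ∀ m m' : Fin n × Fin n, shiftColumn m (r, i) = shiftColumn m (r', i') →
      shiftColumn m' (r, i) = shiftColumn m' (r', i') →
      (![0, m.1, m.2] r = ![0, m'.1, m'.2] r ↔ ![0, m.1, m.2] r' = ![0, m'.1, m'.2] r') :=
    fun m m' h h' => hsolve _ _ _ _ h h'
  have hrows : ∀ r r' : Fin 3, r ≠ r' → (r = 1 ∧ r' = 0 ∨ r = 0 ∧ r' = 1) ∨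
      (r = 2 ∧ r' = 0 ∨ r = 0 ∧ r' = 2) ∨ (r = 1 ∧ r' = 2 ∨ r = 2 ∧ r' = 1) := by decide
  rcases hrows r r' hr with (⟨rfl, rfl⟩ | ⟨rfl, rfl⟩) | (⟨rfl, rfl⟩ | ⟨rfl, rfl⟩) |
    (⟨rfl, rfl⟩ | ⟨rfl, rfl⟩)
  · exact hinj Prod.snd fun m m' h h' hm => Prod.ext ((hv m m' h h').2 rfl) hm
  · exact hinj Prod.snd fun m m' h h' hm => Prod.ext ((hv m m' h h').1 rfl) hm
  · exact hinj Prod.fst fun m m' h h' hm => Prod.ext hm ((hv m m' h h').2 rfl)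
  · exact hinj Prod.fst fun m m' h h' hm => Prod.ext hm ((hv m m' h h').1 rfl)
  · exact hinj Prod.fst fun m m' h h' hm => Prod.ext hm ((hv m m' h h').1 hm)
  · exact hinj Prod.fst fun m m' h h' hm => Prod.ext hm ((hv m m' h h').2 hm)

/-- The new position must collide with one of the |S| old ones, and each collision happens for at
most n pairs of shifts. -/
lemma card_columnInjective_insert_le [NeZero n] (S : Finset (Fin 3 × Fin n)) (j : Fin 3 × Fin n)
    (hj : j ∉ S) :
    Nat.card {m : Fin n × Fin n // S ∈ columnInjective m ∧ insert j S ∉ columnInjective m}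
      ≤ #S * n := by
  rw [Nat.card_eq_fintype_card, Fintype.card_subtype]
  have hsub : ({m : Fin n × Fin n | S ∈ columnInjective m ∧ insert j S ∉ columnInjective m} :
      Finset (Fin n × Fin n)) ⊆ S.biUnion fun p =>
        ({m : Fin n × Fin n | shiftColumn m p = shiftColumn m j} : Finset (Fin n × Fin n)) := by
    intro m hm
    simp only [mem_filter, mem_univ, true_and] at hm
    obtain ⟨h1, h2⟩ := hm
    simp only [mem_biUnion, mem_filter, mem_univ, true_and]
    by_contra! hcon
    rw [mem_columnInjective] at h1 h2
    refine h2 fun p hp q hq h => ?_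
    rcases mem_insert.1 hp with hp' | hp' <;> rcases mem_insert.1 hq with hq' | hq'
    · exact hp'.trans hq'.symm
    · exact absurd (hp' ▸ h.symm) (hcon q hq')
    · exact absurd (hq' ▸ h) (hcon p hp')
    · exact h1 p hp' q hq' h
  refine (card_le_card hsub).trans (card_biUnion_le_card_mul _ _ _ fun p hp => ?_)
  exact card_shiftColumn_eq_le fun h => hj (h ▸ hp)

end ShiftSum

/-! ### The adversary family, the Chernoff bound and the final count -/

section Main

variable {n : ℕ}

/-- The exponent 1/3 arises here: `rare` needs k² · kn ≤ n². -/
lemma adversaryFamily_shiftTables [NeZero n] {k : ℕ} (hk : k ^ 3 ≤ n) :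
    AdversaryFamily (shiftTables (n := n)) columnInjective k where
  nonempty m := ⟨fun _ => false, by simp [mem_shiftTables]⟩
  orthogonal m S hS S' hS' hne := sum_shiftTables_boolChar m hS hS' hne
  empty_mem m := by simp [mem_columnInjective]
  of_insert m S j h := by
    rw [mem_columnInjective] at h ⊢
    exact fun p hp q hq => h p (mem_insert_of_mem hp) q (mem_insert_of_mem hq)
  rare S j hj hS := by
    calc _ ≤ k ^ 2 * (#S * n) := Nat.mul_le_mul_left _ (card_columnInjective_insert_le S j hj)
      _ ≤ k ^ 2 * (k * n) := by gcongr
      _ = k ^ 3 * n := by ring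
      _ ≤ n * n := by gcongr
      _ = _ := by simp

/-- For fixed shifts, exponentially few tables have fewer than `3n/7` odd columns. -/
lemma card_oddColumns_lt_le (m : Fin n × Fin n) :
    (#{x | 7 * oddColumns m x < 3 * n} : ℝ)
      ≤ (((24 / 25) ^ 7 + 1) / (2 * (24 / 25) ^ 3)) ^ n * 8 ^ n := by
  -- The exponential moment is taken at a⁷, so that both sides have integer powers. The optimal base
  -- for the threshold 3/7 is 3/4, and (24/25)⁷ is close to it.
  set a : ℝ := 24 / 25 with ha
  have ha0 : 0 < a := by norm_num [ha]
  have h1 : #{x | 7 * oddColumns m x < 3 * n} * (a ^ 3) ^ n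
      ≤ (a ^ 7 + 1) ^ n * (2 ^ n * 2 ^ n) := by
    rw [← sum_pow_oddColumns m, ← nsmul_eq_mul, ← sum_const]
    refine (sum_le_sum fun x hx => ?_).trans
      (sum_le_sum_of_subset_of_nonneg (filter_subset _ _) fun _ _ _ => by positivity)
    rw [mem_filter] at hx
    rw [← pow_mul, ← pow_mul]
    exact pow_le_pow_of_le_one ha0.le (by norm_num [ha]) hx.2.le
  have h8 : (8 : ℝ) ^ n = 2 ^ n * 2 ^ n * 2 ^ n := by
    rw [← mul_pow, ← mul_pow]; norm_num
  rw [div_pow, mul_pow, div_mul_eq_mul_div, le_div_iff₀ (by positivity), h8]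
  calc _ = 2 ^ n * (#{x | 7 * oddColumns m x < 3 * n} * (a ^ 3) ^ n) := by ring
    _ ≤ 2 ^ n * ((a ^ 7 + 1) ^ n * (2 ^ n * 2 ^ n)) := by gcongr
    _ = _ := by ring

lemma exists_oddColumns_lt [NeZero n] {ε : ℝ} (hε : ε ≤ 1 / 7) {x : Fin 3 × Fin n → Bool}
    (hx : x ∉ shiftSumNegative n ε) : ∃ m, 7 * oddColumns m x < 3 * n := by
  simp only [shiftSumNegative, Set.mem_ofPred_eq, not_forall, not_le] at hx
  obtain ⟨y, ⟨b, c, hy⟩, hd⟩ := hx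
  refine ⟨(b, c), ?_⟩
  have h1 := oddColumns_le_hammingDist (b, c) x y (mem_shiftTables.2 hy)
  have hn : (0 : ℝ) < 3 * n := by
    have : 0 < n := Nat.pos_of_ne_zero (NeZero.ne n)
    positivity
  have h2 := (div_lt_iff₀ hn).1 (hd.trans_le hε)
  have h3 : (7 * hammingDist x y : ℝ) < 3 * n := by linarith
  have h4 : 7 * hammingDist x y < 3 * n := by exact_mod_cast h3
  omega

/-- For large `n`, all but a sixth of the tables are negative. -/
lemma eventually_card_not_negative_le : ∃ n₀ : ℕ, ∀ n ≥ n₀, 0 < n → ∀ ε : ℝ, ε ≤ 1 / 7 →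
    (Nat.card {x // x ∉ shiftSumNegative n ε} : ℝ) ≤ 1 / 6 * 8 ^ n := by
  -- The ratio is less than 1; the factor n² is the number of pairs of shifts in the union bound.
  have ht := tendsto_pow_const_mul_const_pow_of_abs_lt_one 2
    (r := ((24 / 25) ^ 7 + 1) / (2 * (24 / 25) ^ 3)) (by rw [abs_lt]; norm_num)
  obtain ⟨n₀, h₀⟩ := Filter.eventually_atTop.1
    (ht.eventually_le_const (by norm_num : 0 < (1 / 6 : ℝ)))
  refine ⟨n₀, fun n hn hpos ε hε => ?_⟩
  have : NeZero n := ⟨hpos.ne'⟩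
  classical
  rw [Nat.card_eq_fintype_card, Fintype.card_subtype]
  have hsub : ({x | x ∉ shiftSumNegative n ε} : Finset (Fin 3 × Fin n → Bool))
      ⊆ univ.biUnion fun m => {x | 7 * oddColumns m x < 3 * n} := by
    intro x hx
    obtain ⟨m, hm⟩ := exists_oddColumns_lt hε (mem_filter.1 hx).2
    simp only [mem_biUnion, mem_filter, mem_univ, true_and]
    exact ⟨m, hm⟩
  have h1 : (#{x | x ∉ shiftSumNegative n ε} : ℝ)
      ≤ ∑ m : Fin n × Fin n, (#{x | 7 * oddColumns m x < 3 * n} : ℝ) := by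
    exact_mod_cast (card_le_card hsub).trans card_biUnion_le
  refine h1.trans ((sum_le_sum fun m _ => card_oddColumns_lt_le m).trans ?_)
  rw [sum_const, nsmul_eq_mul, ← mul_assoc]
  refine mul_le_mul_of_nonneg_right (le_trans (le_of_eq ?_) (h₀ n hn)) (by positivity)
  simp [sq]

/-- The bound is 1/2 = 1/3 + 1/6: negative tables contribute at most 1/3 each, the others at most 1
each. -/
lemma mean_acceptProb_le {ε : ℝ} (A : QuantumQueryAlgorithm (Fin 3 × Fin n))
    (hA : ∀ x ∈ shiftSumNegative n ε, A.acceptProb x ≤ 1 / 3)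
    (hc : (Nat.card {x // x ∉ shiftSumNegative n ε} : ℝ) ≤ 1 / 6 * 8 ^ n) :
    (Fintype.card (Fin 3 × Fin n → Bool) : ℝ)⁻¹ * ∑ x, A.acceptProb x ≤ 1 / 2 := by
  classical
  have hcard : (Fintype.card (Fin 3 × Fin n → Bool) : ℝ) = 8 ^ n := by
    simp [pow_mul]
  have h1 : ∑ x, A.acceptProb x
      ≤ ∑ x, (1 / 3 + if x ∉ shiftSumNegative n ε then (1 : ℝ) else 0) := by
    refine sum_le_sum fun x _ => ?_
    by_cases hx : x ∈ shiftSumNegative n ε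
    · simpa [hx] using hA x hx
    · have := A.acceptProb_le_one x
      simp only [hx, not_false_eq_true, if_true]
      linarith
  rw [Nat.card_eq_fintype_card, Fintype.card_subtype] at hc
  rw [sum_add_distrib, ← sum_filter, sum_const, sum_const, nsmul_eq_mul, nsmul_eq_mul,
    card_univ, hcard] at h1
  rw [hcard, inv_mul_eq_div, div_le_iff₀ (by positivity)]
  linarith

end Main

theorem mainTheorem3 :
    ∃ c : ℝ, 0 < c ∧ ∃ n₀ : ℕ, ∀ n : ℕ, n₀ ≤ n → ∀ ε : ℝ, 0 < ε → ε ≤ 1 / 7 →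
      ∀ A : QuantumQueryAlgorithm (Fin 3 × Fin n),
        A.Solves (shiftSumPositive n) (shiftSumNegative n ε) →
          c * (n : ℝ) ^ (1 / 3 : ℝ) ≤ (A.queries : ℝ) := by
  obtain ⟨n₀, h₀⟩ := eventually_card_not_negative_le
  -- Here 420 = 2 · 210, because ⌊r⌋ ≥ r/2 once r ≥ 1; this is why n ≥ 1 is required.
  refine ⟨1 / 420, by norm_num, max n₀ 1, fun n hn ε _ hε A hA => ?_⟩
  have hpos : 0 < n := le_of_max_le_right hn
  have : NeZero n := ⟨hpos.ne'⟩
  set r := (n : ℝ) ^ (1 / 3 : ℝ) with hr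
  have hr1 : 1 ≤ r := Real.one_le_rpow (by exact_mod_cast hpos) (by norm_num)
  have hr3 : r ^ 3 = n := by
    rw [hr, ← Real.rpow_natCast, ← Real.rpow_mul (by positivity)]; norm_num
  have hfl : (⌊r⌋₊ : ℝ) ≤ r := Nat.floor_le (by linarith)
  have hk : ⌊r⌋₊ ^ 3 ≤ n := by
    have : (⌊r⌋₊ : ℝ) ^ 3 ≤ n := by rw [← hr3]; gcongr
    exact_mod_cast this
  have hmain := A.le_queries_of_adversaryFamily (adversaryFamily_shiftTables hk)
    (fun m x hx => hA.1 x ⟨m.1, m.2, mem_shiftTables.1 hx⟩)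
    (mean_acceptProb_le A hA.2 (h₀ n (le_of_max_le_left hn) hpos ε hε))
  have h1 : (1 : ℝ) ≤ ⌊r⌋₊ := by exact_mod_cast (Nat.one_le_floor_iff r).2 hr1
  have h2 := Nat.lt_floor_add_one r
  linarith
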